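/- Let $\mathcal L$ be a first-order language. A *topological $\mathcal L$-structure* is a compact Hausdorff, zero-dimensional, second-countable space $A$ with closed relations $r^A\subseteq A^m$ and continuous functions $f^A:A^n\to A$ interpreting the symbols of $\mathcal L$. An *epimorphism* $\phi:B\to A$ is a continuous surjection such that $f^A(\phi(x_1),\dots,\phi(x_n))=\phi(f^B(x_1,\dots,x_n))$ for all function symbols $f$ and $x_i\in B$, and such that, for all relation symbols $r$ and $x_i\in A$, $r^A(x_1,\dots,x_m)$ holds if and only if there are $y_i\in B$ with $\phi(y_i)=x_i$ and $r^B(y_1,\dots,y_m)$. Write $\binom BA$ for the set of epimorphisms from $B$ onto $A$. An *isomorphism* is a bijective epimorphism; $\mathrm{Aut}(A)$ is the group of isomorphisms $A\to A$ with the compact-open topology. A *projective Fraïssé family* is a family $\mathcal G$ of finite topological $\mathcal L$-structures, countable up to isomorphism, such that (JPP) for all $A,B\in\mathcal G$ there is $C\in\mathcal G$ with epimorphisms onto $A$ and onto $B$; and (AP) for all $A,B_1,B_2\in\mathcal G$ and epimorphisms $\phi_i:B_i\to A$ ($i=1,2$) there are $C\in\mathcal G$ and epimorphisms $\phi_3:C\to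 B_1$, $\phi_4:C\to B_2$ with $\phi_1\circ\phi_3=\phi_2\circ\phi_4$. A *projective Fraïssé limit* of $\mathcal G$ is a topological $\mathcal L$-structure $\mathbb G$ such that (L1) every $A\in\mathcal G$ is the image of an epimorphism from $\mathbb G$; (L2) every continuous $f:\mathbb G\to X$ into a finite discrete space has the form $f=f_0\circ\phi$ for some $A\in\mathcal G$, some epimorphism $\phi:\mathbb G\to A$ and some map $f_0:A\to X$; and (L3) for all $A\in\mathcal G$ and epimorphisms $\phi_1,\phi_2:\mathbb G\to A$ there is $\psi\in\mathrm{Aut}(\mathbb G)$ with $\phi_2=\phi_1\circ\psi$. $\mathcal G$ is a *Ramsey class* if for all $A,B\in\mathcal G$ and every integer $r\ge 2$ there is $C\in\mathcal G$ such that for every colouring $c$ of $\binom CA$ with $r$ colours there is $g\in\binom CB$ such that $c$ is constant on $\{f\circ g: f\in\binom BA\}$. A structure $A$ is *rigid* if $\mathrm{Aut}(A)$ is trivial. A topological group is *extremely amenable* if each of its continuous actions on a nonempty compact Hausdorff space has a fixed point. **Theorem 2.8.** Let $\mathcal G$ be a projective Fraïssé family, let $\mathbb G$ be a projective Fraïssé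 limit of $\mathcal G$, and let $G=\mathrm{Aut}(\mathbb G)$. The following are equivalent: 1. $G$ is extremely amenable. 2. $\mathcal G$ is a Ramsey class and every $A\in\mathcal G$ is rigid. -/

import Mathlib

universe u v w w' w'' x

namespace ProjFraisse

/-- A topological `L`-structure: a compact Hausdorff, zero-dimensional (the clopen sets form a
basis), second-countable space in which the relations are closed and the functions continuous. -/
structure TopStructure (L : FirstOrder.Language.{u, v}) where
  carrier : Type w
  [top : TopologicalSpace carrier]
  [compact : CompactSpace carrier]
  [hausdorff : T2Space carrier]
  [secondCountable : SecondCountableTopology carrier]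
  zeroDim : TopologicalSpace.IsTopologicalBasis {s : Set carrier | IsClopen s}
  [str : L.Structure carrier]
  isClosed_rel : ∀ {n : ℕ} (r : L.Relations n),
    IsClosed {y : Fin n → carrier | FirstOrder.Language.Structure.RelMap r y}
  continuous_fun : ∀ {n : ℕ} (f : L.Functions n),
    Continuous fun y : Fin n → carrier => FirstOrder.Language.Structure.funMap f y

variable {L : FirstOrder.Language.{u, v}}

instance : CoeSort (TopStructure.{u, v, w} L) (Type w) := ⟨TopStructure.carrier⟩

attribute [instance] TopStructure.top TopStructure.compact TopStructure.hausdorff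
  TopStructure.secondCountable TopStructure.str

/-- A map of topological `L`-structures is an epimorphism if it is a continuous surjection, it
commutes with the functions, and each relation of the target is the image of the relation of the
source. -/
structure IsEpi {B : TopStructure.{u, v, w} L} {A : TopStructure.{u, v, w'} L} (φ : B → A) :
    Prop where
  continuous : Continuous φ
  surjective : Function.Surjective φ
  map_fun : ∀ {n : ℕ} (f : L.Functions n) (y : Fin n → B),
    FirstOrder.Language.Structure.funMap f (φ ∘ y) = φ (FirstOrder.Language.Structure.funMap f y)
  map_rel : ∀ {n : ℕ} (r : L.Relations n) (z : Fin n → A),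
    FirstOrder.Language.Structure.RelMap r z ↔ ∃ y : Fin n → B, φ ∘ y = z ∧ FirstOrder.Language.Structure.RelMap r y

/-- The set of all epimorphisms from `B` onto `A`. -/
def Epi (B : TopStructure.{u, v, w} L) (A : TopStructure.{u, v, w'} L) : Type (max w w') :=
  {φ : B → A // IsEpi φ}

instance (B : TopStructure.{u, v, w} L) (A : TopStructure.{u, v, w'} L) :
    CoeFun (Epi B A) (fun _ => B → A) := ⟨Subtype.val⟩

theorem IsEpi.id (A : TopStructure.{u, v, w} L) : IsEpi (fun a : A => a) where
  continuous := continuous_id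
  surjective := Function.surjective_id
  map_fun _ _ := rfl
  map_rel _ z := ⟨fun h => ⟨z, rfl, h⟩, by rintro ⟨y, rfl, h⟩; exact h⟩

theorem IsEpi.comp {C : TopStructure.{u, v, w} L} {B : TopStructure.{u, v, w'} L}
    {A : TopStructure.{u, v, w''} L} {f : B → A} {g : C → B} (hf : IsEpi f) (hg : IsEpi g) :
    IsEpi (f ∘ g) where
  continuous := hf.continuous.comp hg.continuous
  surjective := hf.surjective.comp hg.surjective
  map_fun s y := by
    rw [Function.comp_assoc, hf.map_fun, hg.map_fun, Function.comp_apply]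
  map_rel r z := by
    rw [hf.map_rel]
    constructor
    · rintro ⟨y, rfl, hy⟩
      obtain ⟨t, rfl, ht⟩ := (hg.map_rel r y).1 hy
      exact ⟨t, rfl, ht⟩
    · rintro ⟨t, rfl, ht⟩
      exact ⟨g ∘ t, rfl, (hg.map_rel r _).2 ⟨t, rfl, ht⟩⟩

/-- Composition of epimorphisms: `f.comp g = f ∘ g`. -/
def Epi.comp {C : TopStructure.{u, v, w} L} {B : TopStructure.{u, v, w'} L}
    {A : TopStructure.{u, v, w''} L} (f : Epi B A) (g : Epi C B) : Epi C A :=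
  ⟨f.1 ∘ g.1, f.2.comp g.2⟩

theorem IsEpi.symm {X : TopStructure.{u, v, w} L} {g : X ≃ₜ X} (hg : IsEpi (g : X → X)) :
    IsEpi (g.symm : X → X) where
  continuous := g.symm.continuous
  surjective := g.symm.surjective
  map_fun f y := by
    apply g.injective
    rw [← hg.map_fun]
    simp [Function.comp_def]
  map_rel r z := by
    constructor
    · intro h
      exact ⟨g ∘ z, by ext i; simp, (hg.map_rel r _).2 ⟨z, rfl, h⟩⟩
    · rintro ⟨y, rfl, hy⟩
      obtain ⟨t, rfl, ht⟩ := (hg.map_rel r y).1 hy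
      simpa [Function.comp_def] using ht

/-- The automorphism group of a topological `L`-structure, as a group of homeomorphisms under
composition. -/
def autGroup (X : TopStructure.{u, v, w} L) : Subgroup (X ≃ₜ X) where
  carrier := {g | IsEpi (g : X → X)}
  mul_mem' {f g} hf hg :=
    Set.mem_ofPred.2 (IsEpi.comp (f := f) (g := g) (Set.mem_ofPred.1 hf) (Set.mem_ofPred.1 hg))
  one_mem' := Set.mem_ofPred.2 (IsEpi.id X)
  inv_mem' {g} hg := Set.mem_ofPred.2 (IsEpi.symm (g := g) (Set.mem_ofPred.1 hg))

/-- The automorphism group, as a type. -/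
abbrev Aut (X : TopStructure.{u, v, w} L) : Type w := autGroup X

/-- By compactness, the automorphisms are exactly the bijective epimorphisms. -/
theorem exists_aut_iff {X : TopStructure.{u, v, w} L} (φ : X → X) :
    (∃ g : Aut X, ∀ a, g.1 a = φ a) ↔ IsEpi φ ∧ Function.Bijective φ := by
  constructor
  · rintro ⟨g, hg⟩
    obtain rfl : (g.1 : X → X) = φ := funext hg
    exact ⟨g.2, g.1.bijective⟩
  · rintro ⟨h, hb⟩
    exact ⟨⟨(h.continuous.isClosedEmbedding hb.1).isEmbedding.toHomeomorphOfSurjective hb.2, h⟩,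
      fun _ => rfl⟩

/-- An automorphism as an element of the space of continuous self-maps, which carries the
compact-open topology. -/
def Aut.toContinuousMap {X : TopStructure.{u, v, w} L} (g : Aut X) : C(X, X) :=
  ⟨g.1, g.1.continuous⟩

/-- The compact-open topology on the automorphism group. -/
instance (X : TopStructure.{u, v, w} L) : TopologicalSpace (Aut X) :=
  TopologicalSpace.induced Aut.toContinuousMap ContinuousMap.compactOpen

instance (X : TopStructure.{u, v, w} L) : IsTopologicalGroup (Aut X) where
  continuous_mul := by
    have hc : Continuous (Aut.toContinuousMap (X := X)) := continuous_induced_dom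
    refine continuous_induced_rng.2 ?_
    exact ContinuousMap.continuous_comp'.comp
      ((hc.comp continuous_snd).prodMk (hc.comp continuous_fst))
  continuous_inv := by
    have hc : Continuous (Aut.toContinuousMap (X := X)) := continuous_induced_dom
    refine continuous_induced_rng.2 (ContinuousMap.continuous_compactOpen.2 ?_)
    intro K hK U hU
    convert (ContinuousMap.isOpen_setOfPred_mapsTo hU.isClosed_compl.isCompact
      hK.isClosed.isOpen_compl).preimage hc using 1
    ext g
    change (∀ a ∈ K, g.1.symm a ∈ U) ↔ (∀ a ∈ Uᶜ, g.1 a ∈ Kᶜ)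
    constructor
    · intro h a ha hK
      exact ha (by simpa using h _ hK)
    · intro h a ha
      by_contra hU
      exact h _ hU (by simpa using ha)

/-- A topological group is extremely amenable if every continuous action of it on a nonempty
compact Hausdorff space has a fixed point. -/
def ExtremelyAmenable (G : Type w) [Group G] [TopologicalSpace G] [IsTopologicalGroup G] : Prop :=
  ∀ (X : Type x) [TopologicalSpace X] [CompactSpace X] [T2Space X] [Nonempty X]
    [MulAction G X] [ContinuousSMul G X], ∃ p : X, ∀ g : G, g • p = p

/-- A projective Fraïssé family: a family of finite topological `L`-structures, countable up to
isomorphism, with the joint projection and the amalgamation property. -/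
structure IsProjFraisseFamily (𝒢 : Set (TopStructure.{u, v, w} L)) : Prop where
  finite : ∀ A ∈ 𝒢, Finite A
  countable : ∃ S : Set (TopStructure.{u, v, w} L), S ⊆ 𝒢 ∧ S.Countable ∧
    ∀ A ∈ 𝒢, ∃ B ∈ S, ∃ φ : Epi A B, Function.Bijective φ
  jpp : ∀ A ∈ 𝒢, ∀ B ∈ 𝒢, ∃ C ∈ 𝒢, Nonempty (Epi C A) ∧ Nonempty (Epi C B)
  ap : ∀ A ∈ 𝒢, ∀ B₁ ∈ 𝒢, ∀ B₂ ∈ 𝒢, ∀ (φ₁ : Epi B₁ A) (φ₂ : Epi B₂ A),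
    ∃ C ∈ 𝒢, ∃ (φ₃ : Epi C B₁) (φ₄ : Epi C B₂), φ₁.comp φ₃ = φ₂.comp φ₄

/-- A projective Fraïssé limit of a family. -/
structure IsProjFraisseLimit (𝒢 : Set (TopStructure.{u, v, w} L))
    (𝔾 : TopStructure.{u, v, w'} L) : Prop where
  universal : ∀ A ∈ 𝒢, Nonempty (Epi 𝔾 A)
  factor : ∀ (X : Type) [TopologicalSpace X] [DiscreteTopology X] [Finite X] (f : 𝔾 → X),
    Continuous f → ∃ A ∈ 𝒢, ∃ (φ : Epi 𝔾 A) (f₀ : A → X), f = f₀ ∘ φ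
  ultrahomogeneous : ∀ A ∈ 𝒢, ∀ φ₁ φ₂ : Epi 𝔾 A, ∃ ψ : Aut 𝔾, ∀ a : 𝔾, φ₂ a = φ₁ (ψ.1 a)

/-- The Ramsey property for epimorphisms. -/
def IsRamseyClass (𝒢 : Set (TopStructure.{u, v, w} L)) : Prop :=
  ∀ A ∈ 𝒢, ∀ B ∈ 𝒢, ∀ r : ℕ, 2 ≤ r → ∃ C ∈ 𝒢, ∀ c : Epi C A → Fin r,
    ∃ g : Epi C B, ∀ f f' : Epi B A, c (f.comp g) = c (f'.comp g)

/-- A structure is rigid if its only automorphism is the identity. -/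
def IsRigid (A : TopStructure.{u, v, w} L) : Prop :=
  ∀ g : Aut A, g = 1

end ProjFraisse

/-!
The argument is the dynamical dictionary of Kechris, Pestov and Todorcevic, read on epimorphisms.
Write `G = Aut 𝔾`. For `A ∈ 𝒢` the group `G` acts on `Epi 𝔾 A` by precomposition; the action is
transitive by homogeneity, and the stabilizers of its points form a neighbourhood basis of `1` in
`G` (`exists_epi_stabilizer_subset`). By the factorization property of the limit, finitely many
epimorphisms out of `𝔾` factor through a single member of `𝒢` (`exists_common_factor`).

*Extreme amenability gives the Ramsey property* (`isRamseyClass_of_extremelyAmenable`). If `A`, `B`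
and `r` admit no Ramsey witness, every `C ∈ 𝒢` carries a bad colouring, and by compactness these
produce a colouring of `Epi 𝔾 A` that is nonconstant on `{f ∘ γ : f ∈ Epi B A}` for every
`γ ∈ Epi 𝔾 B`. The set of all such colourings is a nonempty compact `G`-space. A fixed point in it
is an invariant colouring, hence constant by transitivity, which is absurd.

*The Ramsey property gives rigidity* (`isRigid_of_isRamseyClass`). If `a ≠ 1` is an automorphism of
`A`, then `Epi C A` has a colouring by `A` under which `ψ` and `a ∘ ψ` always get distinct colours,
contradicting the Ramsey property for the pair `A`, `A`.

*The Ramsey property gives extreme amenability* (`extremelyAmenable_of_isRamseyClass`). Let `G` act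
on a compact space `X`, let `p : X` and let `W` be an entourage. Up to a small error, `g • p`
depends only on `φ ∘ g` for a suitable `φ : Epi 𝔾 A`, so a finite cover of `X` by small sets induces
a finite colouring of `Epi 𝔾 A`. The Ramsey property, transported to `𝔾`, yields for each finite
`F ⊆ G` some `k` such that `φ ∘ f ∘ k` and `φ ∘ k` have the same colour for all `f ∈ F`; the point
`k • p` is then moved by less than `W` by each `f ∈ F`. Compactness turns almost fixed points into
a fixed point (`exists_fixed_of_almost_fixed`).
-/

namespace ProjFraisse

open Filter Topology Uniformity

/-! ### Epimorphisms onto finite structures -/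

theorem Epi.ext {B : TopStructure.{u, v, w} L} {A : TopStructure.{u, v, w'} L} {f g : Epi B A}
    (h : ∀ b, f b = g b) : f = g :=
  Subtype.ext (funext h)

/-- An automorphism, seen as an epimorphism. -/
def Aut.toEpi {X : TopStructure.{u, v, w} L} (g : Aut X) : Epi X X := ⟨g.1, g.2⟩

theorem Epi.comp_mul {X : TopStructure.{u, v, w} L} {A : TopStructure.{u, v, w'} L} (φ : Epi X A)
    (g h : Aut X) : φ.comp (g * h).toEpi = (φ.comp g.toEpi).comp h.toEpi := rfl

theorem Epi.comp_one {X : TopStructure.{u, v, w} L} {A : TopStructure.{u, v, w'} L} (φ : Epi X A) :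
    φ.comp (1 : Aut X).toEpi = φ := rfl

theorem Epi.comp_mul_inv_eq {X : TopStructure.{u, v, w} L} {A : TopStructure.{u, v, w'} L}
    {φ : Epi X A} {g h : Aut X} (H : φ.comp g.toEpi = φ.comp h.toEpi) :
    φ.comp (g * h⁻¹).toEpi = φ := by
  rw [Epi.comp_mul, H, ← Epi.comp_mul, mul_inv_cancel, Epi.comp_one]

theorem Epi.comp_left_injective {C : TopStructure.{u, v, w} L} {B : TopStructure.{u, v, w'} L}
    {A : TopStructure.{u, v, w''} L} (φ : Epi C B) :
    Function.Injective fun e : Epi B A => e.comp φ := by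
  intro e e' h
  refine Epi.ext fun b => ?_
  obtain ⟨c, rfl⟩ := φ.2.surjective b
  exact congrFun (congrArg Subtype.val h) c

/-- If `e ∘ φ` and `φ` are epimorphisms and the middle structure is finite, so is `e`. -/
theorem IsEpi.of_comp {C : TopStructure.{u, v, w} L} {B : TopStructure.{u, v, w'} L}
    {A : TopStructure.{u, v, w''} L} [Finite B] {e : B → A} {φ : C → B} (hφ : IsEpi φ)
    (h : IsEpi (e ∘ φ)) : IsEpi e where
  continuous := continuous_of_discreteTopology
  surjective := h.surjective.of_comp
  map_fun s y := by
    choose t ht using fun i => hφ.surjective (y i)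
    obtain rfl : φ ∘ t = y := funext ht
    rw [← Function.comp_assoc, h.map_fun, hφ.map_fun, Function.comp_apply]
  map_rel r z := by
    rw [h.map_rel]
    constructor
    · rintro ⟨t, rfl, ht⟩
      exact ⟨φ ∘ t, rfl, (hφ.map_rel r _).2 ⟨t, rfl, ht⟩⟩
    · rintro ⟨y, rfl, hy⟩
      obtain ⟨t, rfl, ht⟩ := (hφ.map_rel r y).1 hy
      exact ⟨t, rfl, ht⟩

instance (B : TopStructure.{u, v, w} L) (A : TopStructure.{u, v, w'} L) [Finite B] [Finite A] :
    Finite (Epi B A) :=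
  inferInstanceAs (Finite {φ : B → A // IsEpi φ})

/-- An epimorphism onto a finite structure is determined by its fibres, which are clopen, and a
second-countable profinite space has only countably many clopen sets. -/
theorem countable_epi (X : TopStructure.{u, v, w} L) (A : TopStructure.{u, v, w'} L) [Finite A] :
    Countable (Epi X A) := by
  have : TotallySeparatedSpace X := totallySeparatedSpace_of_t0_of_basis_clopen X.zeroDim
  have : Countable (TopologicalSpace.Clopens X) :=
    TopologicalSpace.Clopens.countable_iff_secondCountable.2 inferInstance
  let fib : Epi X A → A → TopologicalSpace.Clopens X := fun φ a =>
    ⟨φ ⁻¹' {a}, (isClopen_discrete {a}).preimage φ.2.continuous⟩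
  refine Function.Injective.countable (f := fib) fun φ ψ h => Epi.ext fun x => ?_
  have hx : x ∈ fib ψ (φ x) := by
    rw [← h]
    rfl
  exact Eq.symm hx

/-! ### The limit and its automorphism group -/

variable {𝒢 : Set (TopStructure.{u, v, w} L)} {𝔾 : TopStructure.{u, v, w'} L}

/-- The factorization property of the limit, for finite discrete spaces in any universe. -/
theorem IsProjFraisseLimit.exists_factor (h𝔾 : IsProjFraisseLimit 𝒢 𝔾) {T : Type*}
    [TopologicalSpace T] [DiscreteTopology T] [Finite T] {f : 𝔾 → T} (hf : Continuous f) :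
    ∃ A ∈ 𝒢, ∃ (φ : Epi 𝔾 A) (f₀ : A → T), ∀ x, f x = f₀ (φ x) := by
  obtain ⟨n, ⟨e⟩⟩ := Finite.exists_equiv_fin T
  obtain ⟨A, hA, φ, f₀, h⟩ := h𝔾.factor (Fin n) (e ∘ f) (continuous_of_discreteTopology.comp hf)
  refine ⟨A, hA, φ, e.symm ∘ f₀, fun x => ?_⟩
  exact e.eq_symm_apply.2 (congrFun h x)

/-- Finitely many epimorphisms from the limit onto a member of the family factor through a single
epimorphism onto a member of the family. -/
theorem exists_common_factor (h𝒢 : IsProjFraisseFamily 𝒢) (h𝔾 : IsProjFraisseLimit 𝒢 𝔾)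
    {ι : Type*} [Finite ι] {B : TopStructure.{u, v, w} L} (hB : B ∈ 𝒢) (γ : ι → Epi 𝔾 B) :
    ∃ C ∈ 𝒢, ∃ φ : Epi 𝔾 C, ∀ i, ∃ e : Epi C B, e.comp φ = γ i := by
  have := h𝒢.finite B hB
  obtain ⟨C, hC, φ, f₀, h⟩ := h𝔾.exists_factor (f := fun x i => γ i x)
    (continuous_pi fun i => (γ i).2.continuous)
  have := h𝒢.finite C hC
  refine ⟨C, hC, φ, fun i => ?_⟩
  have hi : (fun c => f₀ c i) ∘ φ.1 = (γ i).1 := funext fun x => (congrFun (h x) i).symm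
  exact ⟨⟨fun c => f₀ c i, φ.2.of_comp (hi ▸ (γ i).2)⟩, Subtype.ext hi⟩

theorem IsProjFraisseLimit.exists_aut (h𝔾 : IsProjFraisseLimit 𝒢 𝔾)
    {A : TopStructure.{u, v, w} L} (hA : A ∈ 𝒢) (φ ψ : Epi 𝔾 A) :
    ∃ g : Aut 𝔾, φ.comp g.toEpi = ψ := by
  obtain ⟨g, hg⟩ := h𝔾.ultrahomogeneous A hA φ ψ
  exact ⟨g, Epi.ext fun x => (hg x).symm⟩

/-- The orbit map `g ↦ φ ∘ g` of an epimorphism onto a finite structure is locally constant. -/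
theorem eventually_comp_eq {A : TopStructure.{u, v, w} L} [Finite A] (φ : Epi 𝔾 A) (g : Aut 𝔾) :
    ∀ᶠ h in 𝓝 g, φ.comp h.toEpi = φ.comp g.toEpi := by
  have hc : Continuous (Aut.toContinuousMap (X := 𝔾)) := continuous_induced_dom
  have key : ∀ a : A, ∀ᶠ h in 𝓝 g,
      Set.MapsTo h.toContinuousMap ((φ.comp g.toEpi).1 ⁻¹' {a}) (φ.1 ⁻¹' {a}) := by
    intro a
    have hmaps : Set.MapsTo g.toContinuousMap ((φ.comp g.toEpi).1 ⁻¹' {a}) (φ.1 ⁻¹' {a}) :=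
      fun x hx => hx
    refine hc.continuousAt.eventually (ContinuousMap.eventually_mapsTo ?_ ?_ hmaps)
    · exact ((isClosed_discrete {a}).preimage (φ.comp g.toEpi).2.continuous).isCompact
    · exact (isOpen_discrete {a}).preimage φ.2.continuous
  filter_upwards [eventually_all.2 key] with h hh
  exact Epi.ext fun x => hh _ rfl

/-- Every neighbourhood of `1` contains the stabilizer of an epimorphism onto a member of the
family. Together with `eventually_comp_eq`, such stabilizers form a neighbourhood basis. -/
theorem exists_epi_stabilizer_subset (h𝒢 : IsProjFraisseFamily 𝒢) (h𝔾 : IsProjFraisseLimit 𝒢 𝔾)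
    {U : Set (Aut 𝔾)} (hU : U ∈ 𝓝 1) :
    ∃ A ∈ 𝒢, ∃ φ : Epi 𝔾 A, ∀ g : Aut 𝔾, φ.comp g.toEpi = φ → g ∈ U := by
  -- The sets containing such a stabilizer form a filter; it suffices that it converges to `1`.
  let l : Filter (Aut 𝔾) :=
    { sets := {U | ∃ A ∈ 𝒢, ∃ φ : Epi 𝔾 A, ∀ g : Aut 𝔾, φ.comp g.toEpi = φ → g ∈ U}
      univ_sets := by
        obtain ⟨A, hA, φ, -, -⟩ := h𝔾.exists_factor (f := fun _ : 𝔾 => ()) continuous_const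
        exact ⟨A, hA, φ, fun _ _ => trivial⟩
      sets_of_superset := by
        rintro U V ⟨A, hA, φ, h⟩ hUV
        exact ⟨A, hA, φ, fun g hg => hUV (h g hg)⟩
      inter_sets := by
        rintro U V ⟨A, hA, φ, h⟩ ⟨B, hB, ψ, h'⟩
        have := h𝒢.finite A hA
        have := h𝒢.finite B hB
        obtain ⟨C, hC, χ, f₀, hf⟩ := h𝔾.exists_factor (f := fun x => (φ x, ψ x))
          (φ.2.continuous.prodMk ψ.2.continuous)
        refine ⟨C, hC, χ, fun g hg => ?_⟩
        have hx : ∀ x, (φ (g.1 x), ψ (g.1 x)) = (φ x, ψ x) := fun x => by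
          rw [hf, hf, ← congrFun (congrArg Subtype.val hg) x]
          rfl
        exact ⟨h g (Epi.ext fun x => congrArg Prod.fst (hx x)),
          h' g (Epi.ext fun x => congrArg Prod.snd (hx x))⟩ }
  suffices h : l ≤ 𝓝 1 from h hU
  have ht : Tendsto Aut.toContinuousMap l (𝓝 (Aut.toContinuousMap (1 : Aut 𝔾))) := by
    rw [ContinuousMap.tendsto_nhds_compactOpen]
    intro K hK O hO hKO
    -- A clopen set separates `K` from the complement of `O`; its indicator factors through some
    -- epimorphism, whose stabilizer therefore preserves it.
    obtain ⟨D, hD, hKD, hDO⟩ : ∃ D : Set 𝔾, IsClopen D ∧ K ⊆ D ∧ D ⊆ O := by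
      have hD : ∀ x ∈ K, ∃ D : Set 𝔾, IsClopen D ∧ x ∈ D ∧ D ⊆ O := fun x hx => by
        obtain ⟨D, hD, hxD, hDO⟩ := 𝔾.zeroDim.exists_subset_of_mem_open (hKO hx) hO
        exact ⟨D, hD, hxD, hDO⟩
      choose! D hD hxD hDO using hD
      obtain ⟨t, htK, ht⟩ := hK.elim_nhds_subcover D fun x hx => (hD x hx).isOpen.mem_nhds (hxD x hx)
      exact ⟨⋃ x ∈ t, D x, t.finite_toSet.isClopen_biUnion fun x hx => hD x (htK x hx), ht,
        Set.iUnion₂_subset fun x hx => hDO x (htK x hx)⟩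
    obtain ⟨A, hA, φ, f₀, hf⟩ := h𝔾.exists_factor ((continuous_boolIndicator_iff_isClopen D).2 hD)
    refine ⟨A, hA, φ, fun g hg x hx => hDO ((D.mem_iff_boolIndicator _).2 ?_)⟩
    have hgx : φ (g.1 x) = φ x := congrFun (congrArg Subtype.val hg) x
    change D.boolIndicator (g.1 x) = true
    rw [hf, hgx, ← hf]
    exact (D.mem_iff_boolIndicator x).1 (hKD hx)
  rw [nhds_induced]
  exact tendsto_iff_comap.1 ht

/-! ### Fixed points -/

/-- Extreme amenability for phase spaces of any universe that are small in the universe of the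
definition, with the action given as a jointly continuous function. -/
theorem ExtremelyAmenable.exists_fixed {G : Type w} [Group G] [TopologicalSpace G]
    [IsTopologicalGroup G] (hG : ExtremelyAmenable.{w, x} G) {Y : Type*} [Small.{x} Y]
    [TopologicalSpace Y] [CompactSpace Y] [T2Space Y] [Nonempty Y] (act : G → Y → Y)
    (hone : ∀ y, act 1 y = y) (hmul : ∀ g h y, act (g * h) y = act g (act h y))
    (hact : Continuous fun z : G × Y => act z.1 z.2) : ∃ y, ∀ g, act g y = y := by
  let e := equivShrink.{x} Y
  let : TopologicalSpace (Shrink.{x} Y) := TopologicalSpace.induced e.symm inferInstance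
  let E : Shrink.{x} Y ≃ₜ Y := e.symm.toHomeomorphOfIsInducing ⟨rfl⟩
  have : CompactSpace (Shrink.{x} Y) := E.symm.compactSpace
  have : T2Space (Shrink.{x} Y) := E.symm.t2Space
  let : MulAction G (Shrink.{x} Y) :=
    { smul := fun g y => E.symm (act g (E y))
      one_smul := fun y => by
        change E.symm (act 1 (E y)) = y
        rw [hone, E.symm_apply_apply]
      mul_smul := fun g h y => by
        change E.symm (act (g * h) (E y)) = E.symm (act g (E (E.symm (act h (E y)))))
        rw [hmul, E.apply_symm_apply] }
  have : ContinuousSMul G (Shrink.{x} Y) :=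
    ⟨E.symm.continuous.comp
      (hact.comp (continuous_fst.prodMk (E.continuous.comp continuous_snd)))⟩
  have : Nonempty (Shrink.{x} Y) := E.toEquiv.nonempty
  obtain ⟨p, hp⟩ := hG (Shrink.{x} Y)
  exact ⟨E p, fun g => E.symm_apply_eq.1 (hp g)⟩

/-- On a compact Hausdorff space, points that are almost fixed by finite parts of the group, up to
any entourage, accumulate at a fixed point. -/
theorem exists_fixed_of_almost_fixed {G X : Type*} [Group G] [UniformSpace X] [CompactSpace X]
    [T2Space X] [Nonempty X] [MulAction G X] [ContinuousConstSMul G X]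
    (h : ∀ (F : Finset G), ∀ V ∈ 𝓤 X, ∃ p : X, ∀ g ∈ F, (p, g • p) ∈ V) :
    ∃ p : X, ∀ g : G, g • p = p := by
  choose! p hp using h
  -- The entourages, converging to the diagonal; `smallSets` alone also contains sets that are not
  -- entourages, for which `p` is arbitrary.
  let l₀ : Filter (Set (X × X)) := (𝓤 X).smallSets ⊓ 𝓟 (𝓤 X).sets
  have : NeBot l₀ := inf_principal_neBot_iff.2 fun S hS => by
    obtain ⟨V, hV, h⟩ := eventually_smallSets.1 hS
    exact ⟨V, h V subset_rfl, hV⟩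
  let l : Filter (Finset G × Set (X × X)) := atTop ×ˢ l₀
  let 𝒰 : Ultrafilter (Finset G × Set (X × X)) := Ultrafilter.of l
  let q : Finset G × Set (X × X) → X := fun z => p z.1 z.2
  obtain ⟨a, -, ha⟩ := isCompact_univ.ultrafilter_le_nhds (𝒰.map q) (by simp)
  have ha : Tendsto q 𝒰 (𝓝 a) := ha
  refine ⟨a, fun g => ?_⟩
  have hclose : Tendsto (fun z => (q z, g • q z)) 𝒰 (𝓤 X) := by
    refine Tendsto.mono_left ?_ (Ultrafilter.of_le l)
    intro V hV
    have h1 : ∀ᶠ F : Finset G in atTop, g ∈ F := by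
      filter_upwards [eventually_ge_atTop {g}] with F hF
      exact hF (Finset.mem_singleton_self g)
    have h2 : ∀ᶠ W in l₀, W ⊆ V :=
      (eventually_smallSets_subset.2 hV).filter_mono inf_le_left
    have h3 : ∀ᶠ W in l₀, W ∈ 𝓤 X := mem_inf_of_right (mem_principal_self _)
    change ∀ᶠ z in l, (q z, g • q z) ∈ V
    filter_upwards [h1.prod_mk (h2.and h3)] with z hz
    exact hz.2.1 (hp z.1 z.2 hz.2.2 g hz.1)
  exact tendsto_nhds_unique ((continuous_const_smul g).continuousAt.tendsto.comp ha)
    (ha.congr_uniformity hclose)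

/-- In a continuous action on a compact space, elements near `1` move all points uniformly little. -/
theorem eventually_forall_smul_close {G X : Type*} [Group G] [TopologicalSpace G] [UniformSpace X]
    [CompactSpace X] [MulAction G X] [ContinuousSMul G X] {V : Set (X × X)} (hV : V ∈ 𝓤 X) :
    ∀ᶠ g in 𝓝 (1 : G), ∀ p : X, (p, g • p) ∈ V := by
  have h := isCompact_univ.eventually_forall_of_forall_eventually (x₀ := (1 : G))
    (K := (Set.univ : Set X)) (P := fun g p => (p, g • p) ∈ V) fun p _ => by
      have hc : Continuous fun z : G × X => (z.2, z.1 • z.2) := by fun_prop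
      refine hc.continuousAt.eventually (p := (· ∈ V)) ?_
      beta_reduce
      rw [one_smul]
      exact nhds_le_uniformity p hV
  simpa using h

/-! ### The equivalence -/

/-- The Ramsey property for colourings of epimorphisms out of the limit. -/
theorem IsRamseyClass.exists_monochromatic (hR : IsRamseyClass 𝒢) (h𝔾 : IsProjFraisseLimit 𝒢 𝔾)
    {A B : TopStructure.{u, v, w} L} (hA : A ∈ 𝒢) (hB : B ∈ 𝒢) {κ : Type*} [Finite κ]
    (c : Epi 𝔾 A → κ) : ∃ γ : Epi 𝔾 B, ∀ f f' : Epi B A, c (f.comp γ) = c (f'.comp γ) := by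
  obtain ⟨n, ⟨e⟩⟩ := Finite.exists_equiv_fin κ
  -- Two spare colours meet the requirement of at least two colours.
  obtain ⟨C, hC, h⟩ := hR A hA B hB (n + 2) (Nat.le_add_left 2 n)
  obtain ⟨δ⟩ := h𝔾.universal C hC
  obtain ⟨g, hg⟩ := h fun f => Fin.castAdd 2 (e (c (f.comp δ)))
  exact ⟨g.comp δ, fun f f' => e.injective (Fin.castAdd_injective n 2 (hg f f'))⟩

theorem extremelyAmenable_of_isRamseyClass (h𝒢 : IsProjFraisseFamily 𝒢)
    (h𝔾 : IsProjFraisseLimit 𝒢 𝔾) (hR : IsRamseyClass 𝒢) :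
    ExtremelyAmenable.{w', x} (Aut 𝔾) := by
  intro X _ _ _ _ _ _
  let : UniformSpace X := uniformSpaceOfCompactR1
  refine exists_fixed_of_almost_fixed fun F W hW => ?_
  obtain ⟨V', hV', hsymm', hVW⟩ := comp_symm_mem_uniformity_sets hW
  obtain ⟨V, hV, hsymm, hVV⟩ := comp_symm_mem_uniformity_sets hV'
  obtain ⟨A, hA, φ, hφ⟩ :=
    exists_epi_stabilizer_subset h𝒢 h𝔾 (eventually_forall_smul_close (G := Aut 𝔾) hV)
  have := h𝒢.finite A hA
  obtain ⟨p⟩ := ‹Nonempty X›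
  obtain ⟨t, htf, ht⟩ := (isCompact_univ (X := X)).totallyBounded V hV
  have := htf.to_subtype
  have hcen : ∀ y : X, ∃ z : t, (y, z.1) ∈ V := fun y => by
    obtain ⟨z, hz, hyz⟩ := Set.mem_iUnion₂.1 (ht (Set.mem_univ y))
    exact ⟨⟨z, hz⟩, hyz⟩
  choose cen hcen using hcen
  choose s hs using fun ψ : Epi 𝔾 A => h𝔾.exists_aut hA φ ψ
  -- The section `s` makes the colour `c (φ ∘ g)` well defined; it approximates `g • p`.
  let c : Epi 𝔾 A → t := fun ψ => cen (s ψ • p)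
  have happrox : ∀ g : Aut 𝔾, (g • p, (c (φ.comp g.toEpi)).1) ∈ V' := fun g => by
    have h1 := hφ _ (Epi.comp_mul_inv_eq (hs (φ.comp g.toEpi)).symm) (s (φ.comp g.toEpi) • p)
    rw [smul_smul, inv_mul_cancel_right] at h1
    exact hVV ⟨_, hsymm.symm _ _ h1, hcen _⟩
  obtain ⟨B, hB, γ, hγ⟩ := exists_common_factor h𝒢 h𝔾 hA
    (fun o : Option F => φ.comp (o.elim 1 Subtype.val : Aut 𝔾).toEpi)
  choose e he using hγ
  obtain ⟨γ', hγ'⟩ := hR.exists_monochromatic h𝔾 hA hB c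
  obtain ⟨k, rfl⟩ := h𝔾.exists_aut hB γ γ'
  -- `none` stands for the identity, so every `φ ∘ f ∘ k` gets the colour of `φ ∘ k`.
  refine ⟨k • p, fun f hf => ?_⟩
  have hcol := hγ' (e none) (e (some ⟨f, hf⟩))
  change c (((e none).comp γ).comp k.toEpi) = c (((e (some ⟨f, hf⟩)).comp γ).comp k.toEpi) at hcol
  rw [he, he, ← Epi.comp_mul, ← Epi.comp_mul] at hcol
  have h1 := happrox k
  have h2 := happrox (f * k)
  have h0 : c (φ.comp k.toEpi) = c (φ.comp (f * k).toEpi) := by simpa using hcol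
  rw [mul_smul, ← h0] at h2
  exact hVW ⟨_, h1, hsymm'.symm _ _ h2⟩

/-- A nontrivial automorphism `a` of `A` would give a finite colouring separating each
`ψ : Epi C A` from `a ∘ ψ`, which no Ramsey witness `C` admits. -/
theorem isRigid_of_isRamseyClass (h𝒢 : IsProjFraisseFamily 𝒢) (hR : IsRamseyClass 𝒢)
    {A : TopStructure.{u, v, w} L} (hA : A ∈ 𝒢) : IsRigid A := by
  intro a
  by_contra ha
  have := h𝒢.finite A hA
  obtain ⟨y, hy⟩ : ∃ y, a.1 y ≠ y := by
    by_contra! h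
    exact ha (Subtype.ext (Homeomorph.ext h))
  obtain ⟨n, ⟨e⟩⟩ := Finite.exists_equiv_fin A
  obtain ⟨C, -, h⟩ := hR A hA A hA (n + 2) (Nat.le_add_left 2 n)
  -- The points of `C` that `ψ` sends outside the fixed set of `a`. This set is the same for `ψ` and
  -- `a ∘ ψ`, so the value of `ψ` at a point chosen from it gets moved by `a`.
  let S : Epi C A → Set C := fun ψ => {t | a.1 (ψ t) ≠ ψ t}
  have hS : ∀ ψ, (S ψ).Nonempty := fun ψ => by
    obtain ⟨t, rfl⟩ := ψ.2.surjective y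
    exact ⟨t, hy⟩
  have hinv : ∀ ψ, S (a.toEpi.comp ψ) = S ψ := fun ψ => by
    ext t
    exact a.1.injective.ne_iff
  have : Nonempty C := (hS ((h fun _ => 0).choose)).to_type
  let c : Epi C A → A := fun ψ => ψ (Classical.epsilon (· ∈ S ψ))
  obtain ⟨g, hg⟩ := h fun ψ => Fin.castAdd 2 (e (c ψ))
  have h1 : c g = c (a.toEpi.comp g) :=
    e.injective (Fin.castAdd_injective n 2 (hg ⟨_, IsEpi.id A⟩ a.toEpi))
  have h2 : Classical.epsilon (· ∈ S g) ∈ S g := Classical.epsilon_spec (hS g)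
  refine h2 ?_
  have h3 : c (a.toEpi.comp g) = a.1 (g (Classical.epsilon (· ∈ S g))) := by
    change a.1 (g (Classical.epsilon (· ∈ S (a.toEpi.comp g)))) = _
    rw [hinv]
  exact h3.symm.trans h1.symm

theorem isRamseyClass_of_extremelyAmenable (h𝒢 : IsProjFraisseFamily 𝒢)
    (h𝔾 : IsProjFraisseLimit 𝒢 𝔾) (hG : ExtremelyAmenable.{w', x} (Aut 𝔾)) :
    IsRamseyClass 𝒢 := by
  intro A hA B hB r hr
  by_contra! hbad
  have := h𝒢.finite A hA
  have := h𝒢.finite B hB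
  have := countable_epi 𝔾 A
  have : NeZero r := ⟨by omega⟩
  -- The colourings of `Epi 𝔾 A` that are not constant on `{f ∘ γ : f ∈ Epi B A}`.
  let bad : Epi 𝔾 B → Set (Epi 𝔾 A → Fin r) := fun γ =>
    {c | ∃ f f' : Epi B A, c (f.comp γ) ≠ c (f'.comp γ)}
  have hclosed : ∀ γ, IsClosed (bad γ) := fun γ => by
    simp only [bad, Set.ofPred_exists]
    refine isClosed_iUnion_of_finite fun f => isClosed_iUnion_of_finite fun f' => ?_
    have hc : Continuous fun c : Epi 𝔾 A → Fin r => (c (f.comp γ), c (f'.comp γ)) := by fun_prop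
    exact (isClosed_discrete {z : Fin r × Fin r | z.1 ≠ z.2}).preimage hc
  have hne : (⋂ γ, bad γ).Nonempty := by
    refine CompactSpace.iInter_nonempty hclosed fun s => ?_
    obtain ⟨C, hC, δ, hδ⟩ := exists_common_factor h𝒢 h𝔾 hB (fun γ : s => γ.1)
    obtain ⟨c, hc⟩ := hbad C hC
    refine ⟨Function.extend (fun e : Epi C A => e.comp δ) c 0, Set.mem_iInter₂.2 fun γ hγ => ?_⟩
    obtain ⟨e, rfl⟩ := hδ ⟨γ, hγ⟩
    obtain ⟨f, f', hff⟩ := hc e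
    refine ⟨f, f', ?_⟩
    have hext : ∀ f : Epi B A, Function.extend (fun e : Epi C A => e.comp δ) c 0
        (f.comp (e.comp δ)) = c (f.comp e) := fun f =>
      (Epi.comp_left_injective δ).extend_apply c 0 (f.comp e)
    rwa [hext, hext]
  let Y := ↥(⋂ γ, bad γ)
  have : CompactSpace Y := isCompact_iff_compactSpace.1 (isClosed_iInter hclosed).isCompact
  have : Nonempty Y := hne.to_subtype
  let act : Aut 𝔾 → Y → Y := fun g y =>
    ⟨fun ψ => y.1 (ψ.comp g.toEpi), Set.mem_iInter.2 fun γ =>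
      Set.mem_iInter.1 y.2 (γ.comp g.toEpi)⟩
  have hact : Continuous fun z : Aut 𝔾 × Y => act z.1 z.2 := by
    refine Continuous.subtype_mk (continuous_pi fun ψ => ?_) _
    rw [continuous_iff_continuousAt]
    rintro ⟨g, y⟩
    have hc : Continuous fun z : Aut 𝔾 × Y => z.2.1 (ψ.comp g.toEpi) :=
      (continuous_apply _).comp (continuous_subtype_val.comp continuous_snd)
    refine hc.continuousAt.congr ?_
    filter_upwards [continuous_fst.continuousAt.eventually (eventually_comp_eq ψ g)] with z hz
    rw [hz]
  obtain ⟨y, hy⟩ := hG.exists_fixed act (fun _ => rfl) (fun _ _ _ => rfl) hact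
  obtain ⟨γ⟩ := h𝔾.universal B hB
  obtain ⟨f, f', hff⟩ := Set.mem_iInter.1 y.2 γ
  obtain ⟨g, hg⟩ := h𝔾.exists_aut hA (f.comp γ) (f'.comp γ)
  refine hff ?_
  rw [← hg]
  exact (congrFun (congrArg Subtype.val (hy g)) (f.comp γ)).symm

end ProjFraisse

theorem theorem2p8 {L : FirstOrder.Language.{u, v}}
    (𝒢 : Set (ProjFraisse.TopStructure.{u, v, w} L))
    (h𝒢 : ProjFraisse.IsProjFraisseFamily 𝒢)
    (𝔾 : ProjFraisse.TopStructure.{u, v, w'} L)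
    (h𝔾 : ProjFraisse.IsProjFraisseLimit 𝒢 𝔾) :
    ProjFraisse.ExtremelyAmenable.{w', x} (ProjFraisse.Aut 𝔾) ↔
      ProjFraisse.IsRamseyClass 𝒢 ∧ ∀ A ∈ 𝒢, ProjFraisse.IsRigid A := by
  constructor
  · intro hG
    have hR := ProjFraisse.isRamseyClass_of_extremelyAmenable h𝒢 h𝔾 hG
    exact ⟨hR, fun A hA => ProjFraisse.isRigid_of_isRamseyClass h𝒢 hR hA⟩
  · exact fun h => ProjFraisse.extremelyAmenable_of_isRamseyClass h𝒢 h𝔾 h.1
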